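/- A virtual link diagram $D$ is a nonempty closed 1-manifold (a finite disjoint union of circles) generically immersed in $\mathbb{R}^2$, each double point of which is labelled either as a real crossing (with over/under information) or as a virtual crossing. The arcs of $D$ are the segments between consecutive real crossings (virtual crossings are passed through) and the components without real crossings. The $A$-smoothing of a real crossing connects the two opposite corners swept out when the overstrand is rotated counterclockwise onto the understrand, and the $B$-smoothing connects the other two. A state $\sigma$ is a choice of one of the two smoothings at every real crossing, $\alpha(\sigma)$ and $\beta(\sigma)$ are the numbers of $A$- and $B$-smoothings, $|\sigma|$ is the number of closed curves that result (virtual crossings being left untouched), and the bracket polynomial is $$\langle D\rangle(A,B,d)=\sum_{\sigma}A^{\alpha(\sigma)}B^{\beta(\sigma)}d^{|\sigma|-1}\in\mathbb{Z}[A,B,d].$$ A checkerboard coloring of $D$ shades a small neighbourhood of one side of each arc so that around each real crossing the four corners are alternately shaded and unshaded; $D$ is checkerboard colorable if it has such a coloring. The shading consists of annuli, whose exterior circles run along the arcs and, near a real crossing, jump from one strand to the other around a shaded corner. The signed Tait graph $G_D$ of a checkerboard coloring is the signed cyclic graph (a finite graph with a cyclic order of the half-edges at each vertex and a sign on each edge;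 equivalently, a signed orientable ribbon graph) with one vertex for each annulus and one edge for each real crossing, which joins the annuli of the two shaded corners at that crossing; the half-edges at a vertex are ordered as they occur along the exterior circle. An edge is positive if the $A$-smoothing of its crossing connects the two shaded corners, and negative otherwise. For a signed cyclic graph $G$, some of whose edges may be marked, the polynomial $F[G](A,B,d)$ is defined by the recursion $$F[G]=B\,F[G-e]+A\,F[G(\overline e)]\ \text{ if } e \text{ is positive},\qquad F[G]=A\,F[G-e]+B\,F[G(\overline e)]\ \text{ if } e\text{ is negative},$$ for an arbitrary unmarked edge $e$, where $G-e$ is $G$ with $e$ deleted and $G(\overline e)$ is $G$ with $e$ marked, and by $F[H]=d^{bc(H)-1}$ if all edges of $H$ are marked, where $bc(H)$ is the number of boundary components of the ribbon graph of $H$. For a signed cyclic graph without marks, no edge is marked at the start. **Proposition.** Let $D$ be a checkerboard colorable virtual link diagram and let $G_D$ be the signed Tait graph of any checkerboard coloring of $D$. Then $$\langle D\rangle(A,B,d)=F[G_D](A,B,d).$$ -/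

import Mathlib

noncomputable section

/-! ### Virtual link diagrams -/

/-- The determinant of a pair of plane vectors; it is positive when the second vector lies
counterclockwise from the first one (by an angle less than `π`). -/
def planeDet (u v : ℝ × ℝ) : ℝ := u.1 * v.2 - u.2 * v.1

/-- A virtual link diagram: a (nonempty) closed 1-manifold, that is a disjoint union of `n`
circles `ℝ / ℤ`, generically immersed in the plane, each of whose double points is labelled as
a real crossing (with over/under information) or as a virtual crossing.

The labels are recorded by the set `real`: a double point with preimages `p ≠ q` is a real
crossing at which `p` lies on the overcrossing strand if `(p, q) ∈ real`, a real crossing at which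
`q` lies on the overcrossing strand if `(q, p) ∈ real`, and a virtual crossing if neither pair is
in `real`. -/
structure VirtualLinkDiagram where
  /-- number of components of the 1-manifold -/
  n : ℕ
  n_pos : 0 < n
  /-- the immersion -/
  curve : Fin n → UnitAddCircle → ℝ × ℝ
  smooth : ∀ i, ContDiff ℝ (⊤ : ℕ∞) fun t : ℝ => curve i (t : UnitAddCircle)
  immersed : ∀ i (t : ℝ), deriv (fun t : ℝ => curve i (t : UnitAddCircle)) t ≠ 0
  transverse : ∀ p q : Fin n × UnitAddCircle, p ≠ q → curve p.1 p.2 = curve q.1 q.2 →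
    planeDet (deriv (fun t : ℝ => curve p.1 (p.2 + (t : UnitAddCircle))) 0)
      (deriv (fun t : ℝ => curve q.1 (q.2 + (t : UnitAddCircle))) 0) ≠ 0
  no_triple : ∀ p q r : Fin n × UnitAddCircle, curve p.1 p.2 = curve q.1 q.2 →
    curve q.1 q.2 = curve r.1 r.2 → p = q ∨ q = r ∨ p = r
  finite_double : {x : (Fin n × UnitAddCircle) × (Fin n × UnitAddCircle) |
    x.1 ≠ x.2 ∧ curve x.1.1 x.1.2 = curve x.2.1 x.2.2}.Finite
  /-- the real crossings, as pairs (preimage on the overstrand, preimage on the understrand) -/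
  real : Set ((Fin n × UnitAddCircle) × (Fin n × UnitAddCircle))
  real_double : ∀ x ∈ real, x.1 ≠ x.2 ∧ curve x.1.1 x.1.2 = curve x.2.1 x.2.2
  real_asymm : ∀ p q, (p, q) ∈ real → (q, p) ∉ real

namespace VirtualLinkDiagram

variable (D : VirtualLinkDiagram)

/-- Points of the 1-manifold. -/
abbrev Point : Type := Fin D.n × UnitAddCircle

/-- The velocity of the immersion at a point. -/
def tangent (p : D.Point) : ℝ × ℝ :=
  deriv (fun t : ℝ => D.curve p.1 (p.2 + (t : UnitAddCircle))) 0

/-- The real crossings. -/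
abbrev Crossing : Type := {x // x ∈ D.real}

instance : Finite D.Crossing :=
  (D.finite_double.subset fun x hx => D.real_double x hx).to_subtype

instance : Fintype D.Crossing := Fintype.ofFinite _

/-- A half-edge of the diagram: one of the four ends of arcs at a real crossing. -/
@[ext] structure HalfEdge where
  /-- the real crossing at which the half-edge starts -/
  crossing : D.Crossing
  /-- does it belong to the overstrand? -/
  isOver : Bool
  /-- does it leave the crossing in the direction of the parametrisation? -/
  out : Bool

namespace HalfEdge

variable {D}

/-- The preimage of a crossing on its overstrand (`true`) or understrand (`false`). -/
def pre (c : D.Crossing) (s : Bool) : D.Point := if s then c.1.1 else c.1.2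

/-- The point of the 1-manifold at which the half-edge starts. -/
def point (h : D.HalfEdge) : D.Point := pre h.crossing h.isOver

/-- The direction of the half-edge with respect to the parametrisation. -/
def sgn (h : D.HalfEdge) : ℝ := if h.out then 1 else -1

/-- The plane vector pointing from the crossing along the half-edge. -/
def dir (h : D.HalfEdge) : ℝ × ℝ := h.sgn • D.tangent h.point

/-- The point reached by walking from the crossing along the half-edge for time `t`. -/
def walk (h : D.HalfEdge) (t : ℝ) : D.Point :=
  (h.point.1, h.point.2 + ((h.sgn * t : ℝ) : UnitAddCircle))

/-- The next half-edge at the same crossing in counterclockwise order: the half-edge of the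
other strand that lies counterclockwise (by less than `π`) from `h`. -/
def next (h : D.HalfEdge) : D.HalfEdge where
  crossing := h.crossing
  isOver := !h.isOver
  out := decide (0 < planeDet h.dir (D.tangent (pre h.crossing (!h.isOver))))

/-- `h` and `k` are the two ends of one arc: walking along `h`, the first preimage of a real
crossing that one meets is the starting point of `k`, and one arrives there along `k`.
Virtual crossings are passed through. -/
def IsArc (h k : D.HalfEdge) : Prop :=
  k.out = !h.out ∧ ∃ t : ℝ, 0 < t ∧ k.point = h.walk t ∧
    ∀ s : ℝ, 0 < s → s < t → ∀ m : D.HalfEdge, m.point ≠ h.walk s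

lemma pre_ne (c : D.Crossing) (s : Bool) : pre c s ≠ pre c (!s) := by
  have := (D.real_double c.1 c.2).1
  cases s
  · simpa [pre] using this.symm
  · simpa [pre] using this

lemma curve_pre (c : D.Crossing) (s s' : Bool) :
    D.curve (pre c s).1 (pre c s).2 = D.curve (pre c s').1 (pre c s').2 := by
  have := (D.real_double c.1 c.2).2
  cases s <;> cases s' <;> simp [pre, this]

lemma det_ne (h : D.HalfEdge) :
    planeDet h.dir (D.tangent (pre h.crossing (!h.isOver))) ≠ 0 := by
  have := D.transverse _ _ (pre_ne h.crossing h.isOver) (curve_pre h.crossing h.isOver (!h.isOver))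
  have h2 : planeDet h.dir (D.tangent (pre h.crossing (!h.isOver))) =
      h.sgn * planeDet (D.tangent (pre h.crossing h.isOver))
        (D.tangent (pre h.crossing (!h.isOver))) := by
    simp only [dir, planeDet, point, Prod.smul_fst, Prod.smul_snd, smul_eq_mul]; ring
  rw [h2]
  refine mul_ne_zero ?_ this
  unfold sgn; split <;> norm_num

lemma next_out_eq (h : D.HalfEdge) : h.next.next.out = !h.out := by
  have hd := det_ne h
  rcases h with ⟨c, s, o⟩
  have key : ∀ u v : ℝ × ℝ, planeDet v u = - planeDet u v := fun u v => by
    simp only [planeDet]; ring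
  have lin : ∀ (r : ℝ) (u v : ℝ × ℝ), planeDet (r • u) v = r * planeDet u v := fun r u v => by
    simp only [planeDet, Prod.smul_fst, Prod.smul_snd, smul_eq_mul]; ring
  simp only [next, dir, point, sgn, Bool.not_not, lin] at hd ⊢
  rw [key (D.tangent (pre c s)) (D.tangent (pre c (!s)))]
  set x := planeDet (D.tangent (pre c s)) (D.tangent (pre c (!s)))
  rcases lt_trichotomy x 0 with hx | hx | hx
  · cases o <;> simp [hx, not_lt.2 hx.le]
  · simp [hx] at hd
  · cases o <;> simp [hx, not_lt.2 hx.le]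

lemma next_next (h : D.HalfEdge) : h.next.next = ⟨h.crossing, h.isOver, !h.out⟩ := by
  refine HalfEdge.ext rfl ?_ (next_out_eq h)
  simp [next]

lemma next_four (h : D.HalfEdge) : h.next.next.next.next = h := by
  rw [next_next, next_next]; simp

/-- The counterclockwise rotation at the crossings, as a permutation. -/
def rotate : Equiv.Perm D.HalfEdge where
  toFun := next
  invFun h := h.next.next.next
  left_inv := next_four
  right_inv := next_four

lemma point_inj {h k : D.HalfEdge} (hp : h.point = k.point) :
    h.crossing = k.crossing ∧ h.isOver = k.isOver := by
  obtain ⟨⟨⟨a, b⟩, hc⟩, s, o⟩ := h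
  obtain ⟨⟨⟨a', b'⟩, hc'⟩, s', o'⟩ := k
  have h1 := D.real_double _ hc
  have h2 := D.real_double _ hc'
  have h3 := D.real_asymm a b hc
  cases s <;> cases s' <;> simp [point, pre] at hp h1 h2 ⊢
  · subst hp
    rcases D.no_triple a b a' h1.2 h2.2.symm with h | h | h
    · exact absurd h h1.1
    · exact absurd h.symm h2.1
    · exact ⟨h, rfl⟩
  · subst hp
    rcases D.no_triple a b b' h1.2 h2.2 with h | h | h
    · exact absurd h h1.1
    · exact absurd h h2.1
    · subst h; exact h3 hc'
  · subst hp
    rcases D.no_triple b a a' h1.2.symm h2.2.symm with h | h | h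
    · exact absurd h.symm h1.1
    · exact absurd h.symm h2.1
    · subst h; exact h3 hc'
  · subst hp
    rcases D.no_triple b a b' h1.2.symm h2.2 with h | h | h
    · exact absurd h.symm h1.1
    · exact absurd h h2.1
    · exact ⟨rfl, h⟩

instance : Finite D.HalfEdge :=
  Finite.of_injective (fun h : D.HalfEdge => (h.crossing, h.isOver, h.out)) fun h k e => by
    simp only [Prod.mk.injEq] at e
    exact HalfEdge.ext e.1 e.2.1 e.2.2

lemma IsArc.symm {h k : D.HalfEdge} (a : IsArc h k) : IsArc k h := by
  obtain ⟨ho, t, t0, hp, hm⟩ := a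
  have hs : k.sgn = - h.sgn := by
    unfold sgn; rw [ho]; cases h.out <;> simp
  have hw : ∀ s, k.walk s = h.walk (t - s) := fun s => by
    simp only [walk, hs, hp, Prod.mk.injEq, true_and, add_assoc, ← AddCircle.coe_add]
    congr 2; ring
  refine ⟨by simp [ho], t, t0, ?_, fun s s0 st m => ?_⟩
  · rw [hw]; simp [walk]
  · rw [hw]; exact hm _ (by linarith) (by linarith) m

lemma IsArc.unique {h k l : D.HalfEdge} (a : IsArc h k) (b : IsArc h l) : k = l := by
  obtain ⟨ho, t, t0, hp, hm⟩ := a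
  obtain ⟨ho', t', t0', hp', hm'⟩ := b
  have : t = t' := by
    rcases lt_trichotomy t t' with h1 | h1 | h1
    · exact absurd hp (hm' t t0 h1 k)
    · exact h1
    · exact absurd hp' (hm t' t0' h1 l)
  subst this
  have := point_inj (hp.trans hp'.symm)
  exact HalfEdge.ext this.1 this.2 (ho.trans ho'.symm)

lemma walk_one (h : D.HalfEdge) : h.walk 1 = h.point := by
  have : ((h.sgn * 1 : ℝ) : UnitAddCircle) = 0 := by
    unfold sgn
    split
    · rw [mul_one]; exact AddCircle.coe_period (1 : ℝ)
    · have := AddCircle.coe_period (1 : ℝ)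
      simp only [mul_one, AddCircle.coe_neg, this, neg_zero]
  simp only [walk, this, add_zero]

lemma exists_isArc (h : D.HalfEdge) : ∃ k, IsArc h k := by
  have hs : h.sgn = 1 ∨ h.sgn = -1 := by unfold sgn; split <;> simp
  let T : Set ℝ := {t | t ∈ Set.Ioc (0 : ℝ) 1 ∧ ∃ m : D.HalfEdge, m.point = h.walk t}
  have inj : Set.InjOn h.walk (Set.Ioc (0 : ℝ) 1) := by
    intro t ht t' ht' e
    simp only [walk, Prod.mk.injEq, true_and, add_right_inj] at e
    have e2 : ((h.sgn * t - h.sgn * t' : ℝ) : UnitAddCircle) = 0 := by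
      rw [AddCircle.coe_sub, e, sub_self]
    obtain ⟨z, hz⟩ := (AddCircle.coe_eq_zero_iff (1 : ℝ)).1 e2
    have hz' : (z : ℝ) = h.sgn * (t - t') := by simpa [mul_sub] using hz
    have hb : |(z : ℝ)| < 1 := by
      rw [hz', abs_mul]
      have : |h.sgn| = 1 := by rcases hs with hs | hs <;> simp [hs]
      rw [this, one_mul, abs_lt]
      constructor <;> linarith [ht.1, ht.2, ht'.1, ht'.2]
    have hz0 : z = 0 := by
      rw [← Int.abs_lt_one_iff]; exact_mod_cast hb
    rw [hz0] at hz'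
    rcases hs with hs | hs <;> rw [hs] at hz' <;> push_cast at hz' <;> linarith
  have fin : T.Finite := by
    have : (Set.range (point : D.HalfEdge → D.Point)).Finite := Set.finite_range _
    refine Set.Finite.of_finite_image (f := h.walk) (this.subset ?_) (inj.mono fun t ht => ht.1)
    rintro _ ⟨t, ⟨-, m, hm⟩, rfl⟩
    exact ⟨m, hm⟩
  have ne : T.Nonempty := ⟨1, ⟨by norm_num, le_rfl⟩, h, (walk_one h).symm⟩
  obtain ⟨t, ⟨ht, m, hm⟩, hmin⟩ := Set.exists_min_image T id fin ne
  refine ⟨⟨m.crossing, m.isOver, !h.out⟩, rfl, t, ht.1, hm, fun s s0 st m' hm' => ?_⟩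
  have := hmin s ⟨⟨s0, by linarith [ht.2]⟩, m', hm'⟩
  simp only [id] at this
  linarith

/-- The other end of the arc on which `h` lies. -/
def arc (h : D.HalfEdge) : D.HalfEdge := (exists_isArc h).choose

lemma isArc_arc (h : D.HalfEdge) : IsArc h h.arc := (exists_isArc h).choose_spec

lemma arc_arc (h : D.HalfEdge) : h.arc.arc = h :=
  (isArc_arc h.arc).unique (isArc_arc h).symm

/-- The other end of the arc, as a permutation. -/
def arcPerm : Equiv.Perm D.HalfEdge := ⟨arc, arc, arc_arc, arc_arc⟩

end HalfEdge

/-- The components that meet no real crossing. -/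
abbrev FreeLoop : Type := {i : Fin D.n // ∀ h : D.HalfEdge, h.point.1 ≠ i}

/-! ### The bracket polynomial -/

/-- A state: the choice of a smoothing (`true` for `A`, `false` for `B`) at each real crossing. -/
abbrev State : Type := D.Crossing → Bool

instance : Fintype D.State := Fintype.ofFinite _

/-- How the half-edges are joined in a state: through the arcs of the diagram, and at the
crossings by the smoothings. The `A`-smoothing opens the two corners swept out when the overstrand
is rotated counterclockwise, so it joins each half-edge of the understrand to its counterclockwise
neighbour; the `B`-smoothing joins each half-edge of the overstrand to its counterclockwise
neighbour. -/
inductive StateStep (σ : D.State) : D.HalfEdge → D.HalfEdge → Prop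
  | arc (h) : StateStep σ h h.arc
  | smoothA (h : D.HalfEdge) : σ h.crossing = true → h.isOver = false → StateStep σ h h.next
  | smoothB (h : D.HalfEdge) : σ h.crossing = false → h.isOver = true → StateStep σ h h.next

/-- The closed curves of a state. -/
abbrev StateCurve (σ : D.State) : Type := Quot (D.StateStep σ) ⊕ D.FreeLoop

end VirtualLinkDiagram

/-- The variable `A`. -/
abbrev varA : MvPolynomial (Fin 3) ℤ := MvPolynomial.X 0
/-- The variable `B`. -/
abbrev varB : MvPolynomial (Fin 3) ℤ := MvPolynomial.X 1
/-- The variable `d`. -/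
abbrev varD : MvPolynomial (Fin 3) ℤ := MvPolynomial.X 2

/-- The bracket polynomial, as the sum over the states. -/
def VirtualLinkDiagram.bracket (D : VirtualLinkDiagram) : MvPolynomial (Fin 3) ℤ :=
  ∑ σ : D.State, varA ^ (Finset.univ.filter fun c => σ c = true).card *
    varB ^ (Finset.univ.filter fun c => σ c = false).card *
    varD ^ (Nat.card (D.StateCurve σ) - 1)

/-! ### Signed cyclic graphs and the polynomial `F` -/

/-- A signed cyclic graph: a finite graph (loops, multiple edges and isolated vertices are
allowed) with a cyclic order of the half-edges at each vertex and a sign on each edge. -/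
structure SignedCyclicGraph where
  V : Type
  E : Type
  /-- half-edges -/
  H : Type
  finite_V : Finite V
  finite_E : Finite E
  finite_H : Finite H
  /-- the vertex at which a half-edge is attached -/
  vert : H → V
  /-- the edge to which a half-edge belongs -/
  edge : H → E
  /-- the other half of the edge -/
  opp : H → H
  opp_opp : ∀ h, opp (opp h) = h
  opp_ne : ∀ h, opp h ≠ h
  edge_surj : Function.Surjective edge
  edge_eq_iff : ∀ h k, edge h = edge k ↔ k = h ∨ k = opp h
  /-- the next half-edge, counterclockwise, at the same vertex -/
  rot : Equiv.Perm H
  vert_eq_iff : ∀ h k, vert h = vert k ↔ rot.SameCycle h k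
  sign : E → ℤˣ

namespace SignedCyclicGraph

variable (G : SignedCyclicGraph)

/-- The boundary arcs of the ribbon graph whose vertex discs are the vertices of `G` and whose
edge ribbons are the edges in `S`. On the boundary of the vertex disc, each half-edge `h` of `G`
marks a segment with a clockwise end `(h, false)` and a counterclockwise end `(h, true)`. The
boundary of the disc runs from `(h, true)` to `(rot h, false)`. If the edge of `h` is in `S`, its
ribbon is glued to the segment, and a side of the (untwisted) ribbon runs from `(h, false)` to
the counterclockwise end of the opposite segment; otherwise the segment itself remains in the
boundary. -/
inductive BoundaryStep (S : Set G.E) : G.H × Bool → G.H × Bool → Prop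
  | disc (h) : BoundaryStep S (h, true) (G.rot h, false)
  | ribbon (h) : G.edge h ∈ S → BoundaryStep S (h, false) (G.opp h, true)
  | segment (h) : G.edge h ∉ S → BoundaryStep S (h, false) (h, true)

/-- The boundary components of the ribbon graph of the spanning subgraph with edge set `S`;
an isolated vertex of `G` contributes the boundary of its disc. -/
abbrev BoundaryComponent (S : Set G.E) : Type :=
  Quot (G.BoundaryStep S) ⊕ {v : G.V // ∀ h, G.vert h ≠ v}

/-- `bc` of the spanning subgraph with edge set `S`. -/
def bc (S : Set G.E) : ℕ := Nat.card (G.BoundaryComponent S)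

open Classical in
/-- The deletion-marking recursion. `G.markedF M U` is the value of the polynomial on the spanning
subgraph of `G` whose marked edges are `M` and whose unmarked edges are `U`. If there is an
unmarked edge, such an edge is deleted, respectively marked; the result does not depend on the
edge, see `markedF_recursion`. -/
def markedF (M U : Finset G.E) : MvPolynomial (Fin 3) ℤ :=
  if hU : U.Nonempty then
    if G.sign hU.choose = 1 then
      varB * markedF M (U.erase hU.choose) +
        varA * markedF (insert hU.choose M) (U.erase hU.choose)
    else
      varA * markedF M (U.erase hU.choose) +
        varB * markedF (insert hU.choose M) (U.erase hU.choose)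
  else varD ^ (G.bc (M : Set G.E) - 1)
termination_by U.card
decreasing_by all_goals exact Finset.card_erase_lt_of_mem hU.choose_spec

/-- A spanning subgraph all of whose edges are marked. -/
theorem markedF_marked (M : Finset G.E) : G.markedF M ∅ = varD ^ (G.bc (M : Set G.E) - 1) := by
  rw [markedF]; simp

open Classical in
/-- The recursion holds for every unmarked edge. -/
theorem markedF_recursion (M U : Finset G.E) (e : G.E) (he : e ∈ U) :
    G.markedF M U = if G.sign e = 1 then
        varB * G.markedF M (U.erase e) + varA * G.markedF (insert e M) (U.erase e)
      else varA * G.markedF M (U.erase e) + varB * G.markedF (insert e M) (U.erase e) := by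
  induction hn : U.card using Nat.strong_induction_on generalizing M U e with
  | _ n ih =>
    subst hn
    have hU : U.Nonempty := ⟨e, he⟩
    have hdef := SignedCyclicGraph.markedF.eq_1 G M U
    rw [dif_pos hU] at hdef
    have hf : hU.choose ∈ U := hU.choose_spec
    generalize hU.choose = f at hdef hf
    by_cases hef : e = f
    · subst hef; exact hdef
    · have e1 : e ∈ U.erase f := Finset.mem_erase.2 ⟨hef, he⟩
      have f1 : f ∈ U.erase e := Finset.mem_erase.2 ⟨Ne.symm hef, hf⟩
      have cf := Finset.card_erase_lt_of_mem hf
      have ce := Finset.card_erase_lt_of_mem he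
      rw [hdef, ih _ cf M _ e e1 rfl, ih _ cf (insert f M) _ e e1 rfl,
        ih _ ce M _ f f1 rfl, ih _ ce (insert e M) _ f f1 rfl,
        Finset.erase_right_comm, Finset.insert_comm e f]
      split_ifs <;> ring

/-- The polynomial `F[G]`; initially no edge is marked. -/
def F : MvPolynomial (Fin 3) ℤ :=
  letI := G.finite_E
  letI := Fintype.ofFinite G.E
  G.markedF ∅ Finset.univ

end SignedCyclicGraph

/-! ### Checkerboard colorings and signed Tait graphs -/

namespace VirtualLinkDiagram

/-- A checkerboard coloring: one side of each arc is shaded such that the shading alternates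
around each real crossing. The shaded side is recorded at the two ends of an arc: `ccw h` says that
the shading at the half-edge `h` lies on its counterclockwise side, seen from the crossing where
`h` starts. -/
structure CheckerboardColoring (D : VirtualLinkDiagram) where
  ccw : D.HalfEdge → Bool
  /-- the same side of the arc is shaded at both ends: what is counterclockwise at one end is
  clockwise at the other -/
  ccw_arc : ∀ h, ccw h.arc = !ccw h
  /-- of two consecutive corners at a real crossing exactly one is shaded, and a shaded corner is
  shaded along both half-edges that bound it -/
  ccw_next : ∀ h, ccw h.next = !ccw h
  /-- for the components without real crossings: is the left side shaded? -/
  loopLeft : D.FreeLoop → Bool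

namespace CheckerboardColoring

variable {D : VirtualLinkDiagram} (C : D.CheckerboardColoring)

/-- The exterior circles of the shaded annuli: they run along the arcs, and near a real crossing
they jump from one strand to the other, turning around a shaded corner. -/
inductive ExteriorStep : D.HalfEdge → D.HalfEdge → Prop
  | arc (h) : ExteriorStep h h.arc
  | corner (h) : C.ccw h = true → ExteriorStep h h.next

/-- The annuli of the coloring, one for each exterior circle. -/
abbrev Annulus : Type := Quot C.ExteriorStep ⊕ D.FreeLoop

/-- The shaded corners at the real crossings; `h` stands for the corner between `h` and
`h.next`. -/
abbrev ShadedCorner : Type := {h : D.HalfEdge // C.ccw h = true}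

/-- The opposite shaded corner at the same crossing. -/
def opposite (h : C.ShadedCorner) : C.ShadedCorner :=
  ⟨h.1.next.next, by simp [C.ccw_next, h.2]⟩

/-- The next shaded corner along the exterior circle, which is run through with the annulus on the
left: leave the crossing along `h` and turn around the shaded corner at the other end of the
arc. -/
def nextCorner : Equiv.Perm C.ShadedCorner where
  toFun h := ⟨HalfEdge.rotate.symm h.1.arc, by
    have := C.ccw_next (HalfEdge.rotate.symm h.1.arc)
    have h2 : (HalfEdge.rotate.symm h.1.arc).next = h.1.arc :=
      HalfEdge.rotate.apply_symm_apply _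
    rw [h2, C.ccw_arc, h.2] at this
    simpa using this.symm⟩
  invFun h := ⟨h.1.next.arc, by rw [C.ccw_arc, C.ccw_next, h.2]; rfl⟩
  left_inv h := by
    apply Subtype.ext
    change (HalfEdge.rotate (HalfEdge.rotate.symm h.1.arc)).arc = h.1
    rw [Equiv.apply_symm_apply, HalfEdge.arc_arc]
  right_inv h := by
    apply Subtype.ext
    change HalfEdge.rotate.symm (h.1.next.arc.arc) = h.1
    rw [HalfEdge.arc_arc]
    exact HalfEdge.rotate.symm_apply_apply _

/-- The shaded corner that a half-edge bounds. -/
def cornerOf (h : D.HalfEdge) : C.ShadedCorner :=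
  if hh : C.ccw h = true then ⟨h, hh⟩
  else ⟨HalfEdge.rotate.symm h, by
    have := C.ccw_next (HalfEdge.rotate.symm h)
    have h2 : (HalfEdge.rotate.symm h).next = h := HalfEdge.rotate.apply_symm_apply _
    rw [h2] at this
    simp only [Bool.not_eq_true] at hh
    rw [hh] at this
    simpa using this.symm⟩

lemma mk_eq_iff (x y : C.ShadedCorner) :
    Quot.mk C.ExteriorStep x.1 = Quot.mk C.ExteriorStep y.1 ↔ C.nextCorner.SameCycle x y := by
  have hc : ∀ x : C.ShadedCorner, C.cornerOf x.1 = x := fun x => by simp [cornerOf, x.2]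
  constructor
  · intro e
    have step : ∀ h k, C.ExteriorStep h k →
        C.nextCorner.SameCycle (C.cornerOf h) (C.cornerOf k) := by
      intro h k r
      rcases r with _ | hh
      · by_cases hh : C.ccw h = true
        · have h2 : C.cornerOf h.arc = C.nextCorner (C.cornerOf h) := by
            apply Subtype.ext
            simp [cornerOf, hh, C.ccw_arc, nextCorner]
          rw [h2]
          exact (Equiv.Perm.SameCycle.refl _ _).apply_right
        · have h2 : C.cornerOf h = C.nextCorner (C.cornerOf h.arc) := by
            apply Subtype.ext
            simp [cornerOf, hh, C.ccw_arc, nextCorner, HalfEdge.arc_arc]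
          rw [h2]
          exact (Equiv.Perm.SameCycle.refl _ _).apply_left
      · have h2 : C.cornerOf h.next = C.cornerOf h := by
          apply Subtype.ext
          simp only [cornerOf, hh, C.ccw_next, Bool.not_true, dif_pos]
          exact HalfEdge.rotate.symm_apply_apply h
        rw [h2]
    have := Quot.eqvGen_exact e
    have gen : ∀ h k, Relation.EqvGen C.ExteriorStep h k →
        C.nextCorner.SameCycle (C.cornerOf h) (C.cornerOf k) := by
      intro h k g
      induction g with
      | rel _ _ r => exact step _ _ r
      | refl _ => exact Equiv.Perm.SameCycle.refl _ _
      | symm _ _ _ ih => exact ih.symm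
      | trans _ _ _ _ _ ih1 ih2 => exact ih1.trans ih2
    have := gen _ _ this
    rwa [hc, hc] at this
  · have one : ∀ x : C.ShadedCorner, Quot.mk C.ExteriorStep (C.nextCorner x).1 =
        Quot.mk C.ExteriorStep x.1 := fun x => by
      have h1 := Quot.sound (ExteriorStep.corner (C := C) _ (C.nextCorner x).2)
      have h2 : (C.nextCorner x).1.next = x.1.arc := HalfEdge.rotate.apply_symm_apply _
      rw [h2] at h1
      exact h1.trans (Quot.sound (ExteriorStep.arc (C := C) x.1)).symm
    rintro ⟨z, rfl⟩
    induction z using Int.induction_on with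
    | zero => simp
    | succ n ih =>
      rw [add_comm, zpow_add, zpow_one, Equiv.Perm.mul_apply, one]; exact ih
    | pred n ih =>
      rw [ih, ← one ((C.nextCorner ^ (-(n : ℤ) - 1)) x), ← Equiv.Perm.mul_apply, ← zpow_one_add]
      congr 3; ring_nf

/-- The signed Tait graph of a checkerboard coloring. A vertex disc is glued into each annulus, and
each real crossing gives an edge ribbon that joins the two shaded corners at that crossing; the
half-edges at a vertex are ordered along the boundary of its annulus. An edge is positive if the
`A`-smoothing of its crossing opens (connects) the two shaded corners, that is if the shaded corners
are swept out when the overstrand is rotated counterclockwise, and negative otherwise. -/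
def taitGraph : SignedCyclicGraph where
  V := C.Annulus
  E := D.Crossing
  H := C.ShadedCorner
  finite_V := by
    have : Finite (Quot C.ExteriorStep) := Finite.of_surjective _ Quot.mk_surjective
    infer_instance
  finite_E := inferInstance
  finite_H := inferInstance
  vert h := Sum.inl (Quot.mk _ h.1)
  edge h := h.1.crossing
  opp := C.opposite
  opp_opp h := Subtype.ext (HalfEdge.next_four h.1)
  opp_ne h e := by
    have := congrArg (fun k : C.ShadedCorner => k.1.out) e
    simp [opposite, HalfEdge.next_next] at this
  edge_surj c := by
    by_cases hh : C.ccw ⟨c, true, true⟩ = true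
    · exact ⟨⟨_, hh⟩, rfl⟩
    · exact ⟨⟨(⟨c, true, true⟩ : D.HalfEdge).next, by simpa [C.ccw_next] using hh⟩, rfl⟩
  edge_eq_iff h k := by
    constructor
    · obtain ⟨h, hh⟩ := h
      obtain ⟨k, hk⟩ := k
      intro e
      simp only [opposite, Subtype.mk.injEq, HalfEdge.next_next] at e ⊢
      obtain ⟨c, s, o⟩ := h
      obtain ⟨c', s', o'⟩ := k
      obtain rfl : c = c' := e
      by_cases hs : s' = s
      · subst hs
        by_cases ho : o' = o
        · left; rw [ho]
        · right; congr 1; revert ho; cases o <;> cases o' <;> simp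
      · exfalso
        have h1 := C.ccw_next ⟨c, s, o⟩
        rw [hh] at h1
        have h3 : (⟨c, s', o'⟩ : D.HalfEdge) = HalfEdge.next ⟨c, s, o⟩ ∨
            (⟨c, s', o'⟩ : D.HalfEdge) = (HalfEdge.next ⟨c, s, o⟩).next.next := by
          have hs' : s' = !s := by revert hs; cases s <;> cases s' <;> simp
          rw [HalfEdge.next_next]
          by_cases ho : o' = (HalfEdge.next ⟨c, s, o⟩).out
          · left; exact HalfEdge.ext rfl hs' ho
          · right; refine HalfEdge.ext rfl hs' ?_
            · revert ho; cases o' <;> cases (HalfEdge.next ⟨c, s, o⟩).out <;> simp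
        rcases h3 with h3 | h3
        · rw [h3, h1] at hk; simp at hk
        · rw [h3, C.ccw_next, C.ccw_next, h1] at hk; simp at hk
    · rintro (rfl | rfl) <;> rfl
  rot := C.nextCorner
  vert_eq_iff h k := by
    rw [Sum.inl.injEq]; exact C.mk_eq_iff h k
  sign c := if C.ccw ⟨c, true, true⟩ = true then 1 else -1

end CheckerboardColoring

end VirtualLinkDiagram

end

/-! Both polynomials are sums over the same index set, and they agree term by term. Unwinding the
deletion-marking recursion turns `F` into a sum over sets `T` of edges, the edges that end up marked
(`markedF_eq_sum`). Once a coloring is fixed, a state is also a set of edges: the crossings at which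
its smoothing connects the two shaded corners (`opened`).

The weights agree by the choice of signs: on a positive edge the `A`-smoothing opens the shaded
corners, on a negative edge the `B`-smoothing does, so marking contributes exactly the variable of
the opening smoothing (`weight_eq_prod`).

The exponents of `d` agree because the curves of a state bound the ribbon graph of the opened
crossings (`card_stateCurve`). Each half-edge of the diagram is one side of exactly one shaded
corner, hence one end of a segment on a vertex disc (`sideEquiv`). Under this dictionary arcs of the
diagram are the disc boundary between consecutive segments, a smoothing that opens the shaded
corners supplies the two sides of a ribbon, and the other smoothing supplies the two bare segments.
Components without real crossings correspond to isolated vertices. -/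

namespace SignedCyclicGraph

variable (G : SignedCyclicGraph)

/-! ### Expansion of the recursion over sets of marked edges -/

/-- The factor that an edge contributes when it is marked. -/
noncomputable def markWeight (e : G.E) : MvPolynomial (Fin 3) ℤ :=
  if G.sign e = 1 then varA else varB

/-- The factor that an edge contributes when it is deleted. -/
noncomputable def deleteWeight (e : G.E) : MvPolynomial (Fin 3) ℤ :=
  if G.sign e = 1 then varB else varA

open Classical in
/-- The deletion-marking recursion, expanded over the sets of edges that become marked. -/
theorem markedF_eq_sum (M U : Finset G.E) :
    G.markedF M U = ∑ T ∈ U.powerset, (∏ e ∈ U, if e ∈ T then G.markWeight e else G.deleteWeight e) *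
      varD ^ (G.bc (↑(M ∪ T) : Set G.E) - 1) := by
  induction U using Finset.induction_on generalizing M with
  | empty => simp [markedF_marked]
  | insert a U ha ih =>
    -- Deleting `a` accounts for the subsets that avoid it, marking `a` for those that contain it.
    -- The second use of `ih` has `insert a M` as marked set, which is why `M` is generalized.
    rw [G.markedF_recursion M _ a (Finset.mem_insert_self a U), Finset.erase_insert ha, ih, ih,
      Finset.sum_powerset_insert ha]
    have deleted : ∑ T ∈ U.powerset,
        (∏ e ∈ insert a U, if e ∈ T then G.markWeight e else G.deleteWeight e) *
          varD ^ (G.bc (↑(M ∪ T) : Set G.E) - 1) =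
        G.deleteWeight a * ∑ T ∈ U.powerset,
          (∏ e ∈ U, if e ∈ T then G.markWeight e else G.deleteWeight e) *
            varD ^ (G.bc (↑(M ∪ T) : Set G.E) - 1) := by
      rw [Finset.mul_sum]
      refine Finset.sum_congr rfl fun T hT => ?_
      have haT : a ∉ T := fun h => ha (Finset.mem_powerset.1 hT h)
      rw [Finset.prod_insert ha, if_neg haT, mul_assoc]
    have marked : ∑ T ∈ U.powerset,
        (∏ e ∈ insert a U, if e ∈ insert a T then G.markWeight e else G.deleteWeight e) *
          varD ^ (G.bc (↑(M ∪ insert a T) : Set G.E) - 1) =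
        G.markWeight a * ∑ T ∈ U.powerset,
          (∏ e ∈ U, if e ∈ T then G.markWeight e else G.deleteWeight e) *
            varD ^ (G.bc (↑(insert a M ∪ T) : Set G.E) - 1) := by
      rw [Finset.mul_sum]
      refine Finset.sum_congr rfl fun T _ => ?_
      rw [Finset.prod_insert ha, if_pos (Finset.mem_insert_self a T), mul_assoc,
        Finset.union_insert, Finset.insert_union]
      congr 2
      refine Finset.prod_congr rfl fun e he => ?_
      have hea : e ≠ a := fun h => ha (h ▸ he)
      simp [Finset.mem_insert, hea]
    rw [deleted, marked]
    unfold markWeight deleteWeight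
    split_ifs <;> rfl

end SignedCyclicGraph

/-! ### State curves as boundary components -/

namespace VirtualLinkDiagram

variable {D : VirtualLinkDiagram}

open HalfEdge

/-- With `true` for `A`, the two smoothing rules merge into one Boolean equation: `A` turns
counterclockwise from the understrand, `B` from the overstrand. -/
lemma StateStep.of_eq {σ : D.State} {h : D.HalfEdge} (e : σ h.crossing = !h.isOver) :
    D.StateStep σ h h.next := by
  cases ho : h.isOver
  · exact .smoothA h (by simpa [ho] using e) ho
  · exact .smoothB h (by simpa [ho] using e) ho

/-- Every step runs along an arc or to the counterclockwise neighbour. -/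
lemma StateStep.arc_or_next {σ : D.State} {h k : D.HalfEdge} (r : D.StateStep σ h k) :
    k = h.arc ∨ k = h.next ∧ σ h.crossing = !h.isOver := by
  induction r with
  | arc => exact .inl rfl
  | smoothA h1 h2 => exact .inr ⟨rfl, by rw [h1, h2]; rfl⟩
  | smoothB h1 h2 => exact .inr ⟨rfl, by rw [h1, h2]; rfl⟩

namespace CheckerboardColoring

variable (C : D.CheckerboardColoring)

lemma ccw_next_next (h : D.HalfEdge) : C.ccw h.next.next = C.ccw h := by
  rw [C.ccw_next, C.ccw_next, Bool.not_not]

/-- The two half-edges of one strand are two quarter turns apart, and the shading alternates at each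
turn. -/
lemma ccw_out (c : D.Crossing) (s o o' : Bool) : C.ccw ⟨c, s, o⟩ = C.ccw ⟨c, s, o'⟩ := by
  have key := C.ccw_next_next ⟨c, s, o⟩
  rw [next_next] at key
  cases o <;> cases o' <;> first | rfl | exact key | exact key.symm

/-- The shading at a half-edge is determined by the shading at the overstrand. -/
lemma ccw_eq_over (h : D.HalfEdge) :
    C.ccw h = (h.isOver == C.ccw ⟨h.crossing, true, true⟩) := by
  obtain ⟨c, s, o⟩ := h
  cases s
  · have key := C.ccw_next ⟨c, true, true⟩
    rw [C.ccw_out c false o (next ⟨c, true, true⟩).out]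
    exact key.trans (by simp)
  · rw [C.ccw_out c true o true]; simp

/-- A half-edge is one of the two sides of the shaded corner that it bounds. -/
noncomputable def sideEquiv : C.taitGraph.H × Bool ≃ D.HalfEdge where
  toFun x := if x.2 then x.1.1 else x.1.1.next
  invFun h := (C.cornerOf h, C.ccw h)
  left_inv := by
    rintro ⟨⟨h, hh⟩, b⟩
    cases b
    · refine Prod.ext (Subtype.ext ?_) ?_
      · have hn : C.ccw h.next ≠ true := by simp [C.ccw_next, hh]
        change (C.cornerOf h.next).1 = h
        rw [cornerOf, dif_neg hn]
        exact rotate.symm_apply_apply h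
      · simp [C.ccw_next, hh]
    · refine Prod.ext (Subtype.ext ?_) ?_ <;> simp [cornerOf, hh]
  right_inv h := by
    by_cases hh : C.ccw h = true
    · simp [cornerOf, hh]
    · simp only [cornerOf, hh]
      exact rotate.apply_symm_apply h

/-- The crossings at which a state opens the shaded corners. -/
def opened (σ : D.State) : Set C.taitGraph.E :=
  {c : D.Crossing | σ c = C.ccw ⟨c, true, true⟩}

/-- Makes openness readable from any half-edge at the crossing, since Boolean equality with
`h.isOver` is an involution. At a shaded corner, where `C.ccw h = true`, the criterion becomes `σ
h.crossing = h.isOver`. -/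
lemma mem_opened (σ : D.State) (h : D.HalfEdge) :
    (h.crossing ∈ C.opened σ) ↔ σ h.crossing = (h.isOver == C.ccw h) := by
  have key := C.ccw_eq_over h
  change σ h.crossing = C.ccw ⟨h.crossing, true, true⟩ ↔ _
  rw [key]
  cases h.isOver <;> simp

/-- Each boundary step is a single state step up to direction. If the crossing is opened, the
smoothing joins `h.next` to the opposite corner's first side `h.next.next`, which is a ribbon side;
otherwise it joins `h` to `h.next`, which is the bare segment. -/
lemma quot_eq_of_boundaryStep (σ : D.State) {x y : C.taitGraph.H × Bool}
    (r : C.taitGraph.BoundaryStep (C.opened σ) x y) :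
    Quot.mk (D.StateStep σ) (C.sideEquiv x) = Quot.mk (D.StateStep σ) (C.sideEquiv y) := by
  rcases r with ⟨h⟩ | ⟨h, hS⟩ | ⟨h, hS⟩
  · have e : C.sideEquiv (C.taitGraph.rot h, false) = h.1.arc :=
      rotate.apply_symm_apply h.1.arc
    rw [e]
    exact Quot.sound (.arc h.1)
  · refine Quot.sound (StateStep.of_eq (h := h.1.next) ?_)
    have := (C.mem_opened σ h.1).1 hS
    rw [h.2] at this
    simpa [next] using this
  · refine (Quot.sound (StateStep.of_eq (h := h.1) ?_)).symm
    have := mt (C.mem_opened σ h.1).2 hS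
    rw [h.2] at this
    revert this
    cases σ h.1.crossing <;> cases h.1.isOver <;> simp

lemma quot_eq_of_stateStep (σ : D.State) {h k : D.HalfEdge} (r : D.StateStep σ h k) :
    Quot.mk (C.taitGraph.BoundaryStep (C.opened σ)) (C.sideEquiv.symm h) =
      Quot.mk (C.taitGraph.BoundaryStep (C.opened σ)) (C.sideEquiv.symm k) := by
  obtain ⟨⟨x, b⟩, rfl⟩ := C.sideEquiv.surjective h
  obtain ⟨⟨y, b'⟩, rfl⟩ := C.sideEquiv.surjective k
  simp only [Equiv.symm_apply_apply]
  have disc : ∀ z, C.sideEquiv (C.taitGraph.rot z, false) = (C.sideEquiv (z, true)).arc :=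
    fun z => rotate.apply_symm_apply z.1.arc
  rcases r.arc_or_next with e | ⟨e, hσ⟩
  · cases b
    -- The second side of a corner is where the exterior circle arrives, so its arc leads back to
    -- the first side of the preceding corner `z`.
    · obtain ⟨z, rfl⟩ := C.taitGraph.rot.surjective x
      rw [disc, arc_arc] at e
      rw [C.sideEquiv.injective e]
      exact (Quot.sound (.disc z)).symm
    · rw [← disc] at e
      rw [C.sideEquiv.injective e]
      exact Quot.sound (.disc x)
  · have hx := C.mem_opened σ x.1
    rw [x.2] at hx
    cases b
    · have e' : (y, b') = (C.taitGraph.opp x, true) := C.sideEquiv.injective e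
      rw [e']
      refine Quot.sound (.ribbon x (hx.2 ?_))
      have hσ' : σ x.1.crossing = !!x.1.isOver := hσ
      simpa using hσ'
    · have e' : (y, b') = (x, false) := C.sideEquiv.injective e
      rw [e']
      refine (Quot.sound (.segment x fun hS => ?_)).symm
      have h1 : σ x.1.crossing = _ := hx.1 hS
      have h2 : σ x.1.crossing = !x.1.isOver := hσ
      rw [h1] at h2
      simp at h2

/-- The closed curves of a state that pass a real crossing are the boundary components of the
ribbon graph that pass a half-edge. -/
noncomputable def stateCurveQuotEquiv (σ : D.State) :
    Quot (D.StateStep σ) ≃ Quot (C.taitGraph.BoundaryStep (C.opened σ)) where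
  toFun := Quot.lift (fun h => Quot.mk _ (C.sideEquiv.symm h))
    fun _ _ r => C.quot_eq_of_stateStep σ r
  invFun := Quot.lift (fun x => Quot.mk _ (C.sideEquiv x))
    fun _ _ r => C.quot_eq_of_boundaryStep σ r
  left_inv := by rintro ⟨h⟩; simp
  right_inv := by rintro ⟨x⟩; simp

/-- Of the two ends of an arc exactly one has its counterclockwise side shaded, so every exterior
circle through a half-edge turns around a shaded corner. Such an annulus is therefore never an
isolated vertex. -/
lemma exists_vert_eq (q : Quot C.ExteriorStep) : ∃ h, C.taitGraph.vert h = Sum.inl q := by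
  obtain ⟨h, rfl⟩ := Quot.mk_surjective q
  by_cases hh : C.ccw h = true
  · exact ⟨⟨h, hh⟩, rfl⟩
  · refine ⟨⟨h.arc, by simpa [C.ccw_arc] using hh⟩, ?_⟩
    exact congrArg Sum.inl (Quot.sound (.arc h)).symm

/-- The isolated vertices of the Tait graph are the components without real crossings. -/
noncomputable def freeLoopEquiv : D.FreeLoop ≃ {v : C.taitGraph.V // ∀ h, C.taitGraph.vert h ≠ v} :=
  Equiv.ofBijective (fun i => ⟨Sum.inr i, fun _ => Sum.inl_ne_inr⟩) <| by
    constructor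
    · intro i j e
      exact Sum.inr_injective (congrArg Subtype.val e)
    · rintro ⟨q | i, hv⟩
      · obtain ⟨h, hh⟩ := C.exists_vert_eq q
        exact absurd hh (hv h)
      · exact ⟨i, rfl⟩

/-- The closed curves of a state bound the ribbon graph of the opened crossings. -/
theorem card_stateCurve (σ : D.State) :
    Nat.card (D.StateCurve σ) = C.taitGraph.bc (C.opened σ) :=
  Nat.card_congr ((C.stateCurveQuotEquiv σ).sumCongr C.freeLoopEquiv)

/-! ### Weights and comparison of the two sums -/

lemma sign_eq_one_iff (c : D.Crossing) :
    C.taitGraph.sign c = 1 ↔ C.ccw ⟨c, true, true⟩ = true := by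
  change (if C.ccw ⟨c, true, true⟩ = true then (1 : ℤˣ) else -1) = 1 ↔ _
  split_ifs with hc
  · simp [hc]
  · simp [hc]

open Classical in
/-- The weight of a state, as a product over the edges of the Tait graph. -/
lemma weight_eq_prod (σ : D.State) :
    varA ^ (Finset.univ.filter fun c => σ c = true).card *
      varB ^ (Finset.univ.filter fun c => σ c = false).card =
    ∏ c : D.Crossing, if σ c = C.ccw ⟨c, true, true⟩ then C.taitGraph.markWeight c
      else C.taitGraph.deleteWeight c := by
  have factor : ∀ c : D.Crossing, (if σ c = C.ccw ⟨c, true, true⟩ then C.taitGraph.markWeight c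
      else C.taitGraph.deleteWeight c) = if σ c = true then varA else varB := fun c => by
    simp only [SignedCyclicGraph.markWeight, SignedCyclicGraph.deleteWeight, C.sign_eq_one_iff]
    cases σ c <;> cases C.ccw ⟨c, true, true⟩ <;> simp
  simp only [factor, Finset.prod_ite, Finset.prod_const, Bool.not_eq_true]

end CheckerboardColoring

end VirtualLinkDiagram

-- Reindexes the states by the sets of crossings whose shaded corners they open.
open Classical in
theorem bracket_eq_sum_powerset (D : VirtualLinkDiagram) (C : D.CheckerboardColoring) :
    D.bracket = ∑ T ∈ (Finset.univ : Finset D.Crossing).powerset,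
      (∏ c : D.Crossing, if c ∈ T then C.taitGraph.markWeight c else C.taitGraph.deleteWeight c) *
        varD ^ (C.taitGraph.bc (T : Set D.Crossing) - 1) := by
  unfold VirtualLinkDiagram.bracket
  refine Finset.sum_bij' (fun σ _ => Finset.univ.filter fun c => σ c = C.ccw ⟨c, true, true⟩)
    -- At a crossing in `T` the state takes the opening smoothing, elsewhere the other one; Boolean
    -- equality with a fixed value is its own inverse.
    (fun T _ c => decide (c ∈ T) == C.ccw ⟨c, true, true⟩) (fun _ _ => by simp)
    (fun _ _ => Finset.mem_univ _) (fun σ _ => ?_) (fun T _ => ?_) (fun σ _ => ?_)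
  · funext c
    cases h : σ c <;> cases h' : C.ccw ⟨c, true, true⟩ <;> simp [h, h']
  · ext c
    cases h' : C.ccw ⟨c, true, true⟩ <;> simp [h']
  -- The counts themselves agree, so the truncated subtraction in the exponent needs no positivity
  -- argument.
  · rw [C.weight_eq_prod, C.card_stateCurve]
    congr 1
    · simp
    · congr 3
      ext c
      simp only [Finset.coe_filter, Finset.mem_univ, true_and]
      rfl

theorem proposition4p4 (D : VirtualLinkDiagram) (C : D.CheckerboardColoring) :
    D.bracket = C.taitGraph.F := by
  -- By definition `F` starts with no marks and with the same `Finset.univ`, so the expansion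
  -- applies with `M = ∅`.
  refine (bracket_eq_sum_powerset D C).trans
    ((C.taitGraph.markedF_eq_sum ∅ (Finset.univ : Finset D.Crossing)).trans ?_).symm
  simp only [Finset.empty_union]
  refine Finset.sum_congr rfl fun T _ => congrArg (· * _) (Finset.prod_congr rfl fun c _ => ?_)
  -- Evaluating both `if`s separately avoids having to identify their decidability instances.
  by_cases hc : c ∈ T
  · exact (if_pos hc).trans (if_pos hc).symm
  · exact (if_neg hc).trans (if_neg hc).symm
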